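/- Let $(X,\mathcal B,m)$ be a $\sigma$-finite measure space and let $T:X\to X$ be a conservative, ergodic, measure preserving transformation, not necessarily invertible. Let $\widehat T$ be its transfer operator, which acts on non-negative measurable functions and is determined (up to $m$-null sets) by $\int_B\widehat T f\,dm=\int_{T^{-1}B}f\,dm$ for all $B\in\mathcal B$. Let $\mathcal F=\{B\in\mathcal B:0<m(B)<\infty\}$, and let $L^1_+(m)$ be the set of integrable $f\ge 0$ with $m(f):=\int_X f\,dm>0$. For $A\in\mathcal F$ put $m_A(B)=m(A\cap B)/m(A)$. Call $T$ *weakly pointwise dual ergodic* if there are constants $a_n>0$ $(n\ge1)$ such that for every $f\in L^1_+(m)$ $$\frac1{a_n}\sum_{k=0}^{n-1}\widehat T^k f\longrightarrow m(f)\ \text{ in measure with respect to every finite measure }\nu\ll m,$$ $$\limsup_{n\to\infty}\frac1{a_n}\sum_{k=0}^{n-1}\widehat T^k f=m(f)\quad m\text{-a.e. on }X.$$ Call $A\in\mathcal F$ a *limited set* if there are constants $a_n>0$ $(n\ge1)$ such that, as $n\to\infty$, $$\frac1{a_n}\sum_{k=0}^{n-1}\widehat T^k1_A\longrightarrow m(A)\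 \text{ in measure with respect to } m_A,\qquad \operatorname*{ess\,sup}_{A}\ \frac1{a_n}\sum_{k=0}^{n-1}\widehat T^k1_A\longrightarrow m(A).$$ For $A\in\mathcal F$ and $\lambda>0$ put $$u_A(\lambda)=\sum_{n=0}^\infty e^{-\lambda n}\,\frac{m(A\cap T^{-n}A)}{m(A)^2},\qquad S_n(1_A)=\sum_{k=0}^{n-1}1_A\circ T^k .$$ Call $A\in\mathcal F$ a *moment set* if for every integer $p\ge 0$ (with $0^0=1$) $$\sum_{n=0}^\infty e^{-\lambda n}\int_A S_n(1_A)^p\,dm\ \sim\ p!\,m(A)^{p+1}\,\frac{u_A(\lambda)^p}{\lambda}\qquad\text{as }\lambda\downarrow0 .$$ **Theorem (Moment set theorem).** If $T$ is weakly pointwise dual ergodic and $A\in\mathcal F$ is a limited set, then $A$ is a moment set for $T$. -/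

import Mathlib

open MeasureTheory Filter Topology Asymptotics
open scoped ENNReal

namespace MomentSets

variable {X : Type*} [MeasurableSpace X]

/-- The transfer operator `T̂` of a nonsingular map `T` with respect to `m`, acting on non-negative
functions: `T̂ f` is the density with respect to `m` of the image under `T` of the measure
`f dm`. It is determined up to `m`-null sets by `∫_A T̂ f dm = ∫_{T⁻¹ A} f dm`
(see `setLIntegral_transfer`). -/
noncomputable def transfer (T : X → X) (m : Measure X) (f : X → ℝ≥0∞) : X → ℝ≥0∞ :=
  ((m.withDensity f).map T).rnDeriv m

theorem measurable_transfer (T : X → X) (m : Measure X) (f : X → ℝ≥0∞) :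
    Measurable (transfer T m f) :=
  Measure.measurable_rnDeriv _ _

/-- The defining property of the transfer operator. -/
theorem setLIntegral_transfer {T : X → X} {m : Measure X} [SigmaFinite m]
    (hT : Measure.QuasiMeasurePreserving T m m) {f : X → ℝ≥0∞}
    {A : Set X} (hA : MeasurableSet A) :
    ∫⁻ x in A, transfer T m f x ∂m = ∫⁻ x in T ⁻¹' A, f x ∂m := by
  have hac : (m.withDensity f).map T ≪ m :=
    ((withDensity_absolutelyContinuous m f).map hT.measurable).trans hT.absolutelyContinuous
  rw [transfer, Measure.setLIntegral_rnDeriv hac, Measure.map_apply hT.measurable hA,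
    withDensity_apply f (hT.measurable hA)]

/-- The normalised sums `(1 / a n) * ∑_{k = 0}^{n - 1} T̂ᵏ f`. -/
noncomputable def dualAverage (T : X → X) (m : Measure X) (a : ℕ → ℝ) (f : X → ℝ≥0∞)
    (n : ℕ) (x : X) : ℝ≥0∞ :=
  (∑ k ∈ Finset.range n, (transfer T m)^[k] f x) / ENNReal.ofReal (a n)

/-- Weak pointwise dual ergodicity. Convergence in measure with respect to the `σ`-finite
measure `m` means convergence in measure with respect to every finite `ν ≪ m`. The class
`L¹₊(m)` consists of the non-negative `f` with `0 < ∫ f dm < ∞`; for such `f` the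
normalised sums are integrable, hence finite `m`-almost everywhere, and convergence in measure is
that of the real-valued functions. -/
def WeaklyPointwiseDualErgodic (T : X → X) (m : Measure X) : Prop :=
  ∃ a : ℕ → ℝ, (∀ n, 1 ≤ n → 0 < a n) ∧
    ∀ f : X → ℝ≥0∞, Measurable f → 0 < ∫⁻ x, f x ∂m → ∫⁻ x, f x ∂m < ∞ →
      (∀ ν : Measure X, IsFiniteMeasure ν → ν ≪ m →
        TendstoInMeasure ν (fun n x => (dualAverage T m a f n x).toReal) atTop
          (fun _ => (∫⁻ x, f x ∂m).toReal)) ∧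
      ∀ᵐ x ∂m, limsup (fun n => dualAverage T m a f n x) atTop = ∫⁻ x, f x ∂m

/-- Limited sets: `A` is measurable with `0 < m A < ∞`, the normalised sums of `T̂ᵏ 1_A` converge
to `m A` in measure with respect to `m_A = m(A ∩ ·) / m A`, and their (essential) suprema
over `A` converge to `m A`. -/
def IsLimitedSet (T : X → X) (m : Measure X) (A : Set X) : Prop :=
  MeasurableSet A ∧ 0 < m A ∧ m A < ∞ ∧
    ∃ a : ℕ → ℝ, (∀ n, 1 ≤ n → 0 < a n) ∧
      TendstoInMeasure (ProbabilityTheory.cond m A)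
        (fun n x => (dualAverage T m a (A.indicator 1) n x).toReal) atTop (fun _ => m.real A) ∧
      Tendsto (fun n => essSup (dualAverage T m a (A.indicator 1) n) (m.restrict A))
        atTop (𝓝 (m A))

/-- `u_A(l) = ∑_{n ≥ 0} e^{-l n} m(A ∩ T⁻ⁿ A) / m(A)²`. -/
noncomputable def returnLaplace (T : X → X) (m : Measure X) (A : Set X) (l : ℝ) : ℝ :=
  ∑' n : ℕ, Real.exp (-l * n) * (m.real (A ∩ T^[n] ⁻¹' A) / m.real A ^ 2)

/-- The occupation time `S_n(1_A) = ∑_{k = 0}^{n - 1} 1_A ∘ Tᵏ`. -/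
noncomputable def occupation (T : X → X) (A : Set X) (n : ℕ) (x : X) : ℝ :=
  ∑ k ∈ Finset.range n, A.indicator (fun _ => (1 : ℝ)) (T^[k] x)

/-- `∑_{n ≥ 0} e^{-l n} ∫_A S_n(1_A)^p dm`. -/
noncomputable def momentLaplace (T : X → X) (m : Measure X) (A : Set X) (p : ℕ) (l : ℝ) : ℝ :=
  ∑' n : ℕ, Real.exp (-l * n) * ∫ x in A, occupation T A n x ^ p ∂m

/-- Moment sets. -/
def IsMomentSet (T : X → X) (m : Measure X) (A : Set X) : Prop :=
  MeasurableSet A ∧ 0 < m A ∧ m A < ∞ ∧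
    ∀ p : ℕ, (fun l : ℝ => momentLaplace T m A p l) ~[𝓝[>] 0]
      (fun l : ℝ => (p.factorial : ℝ) * m.real A ^ (p + 1) * (returnLaplace T m A l ^ p / l))

set_option linter.unusedSectionVars false

theorem occupation_nonneg (T : X → X) (A : Set X) (n : ℕ) (x : X) : 0 ≤ occupation T A n x :=
  Finset.sum_nonneg fun k _ =>
    Set.indicator_nonneg (f := fun _ => (1 : ℝ)) (fun _ _ => zero_le_one) (T^[k] x)

theorem occupation_le (T : X → X) (A : Set X) (n : ℕ) (x : X) : occupation T A n x ≤ n := by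
  classical
  calc occupation T A n x ≤ ∑ _k ∈ Finset.range n, (1 : ℝ) := by
        refine Finset.sum_le_sum fun k _ => ?_
        by_cases h : T^[k] x ∈ A <;> simp [h]
    _ = n := by simp

theorem measurable_occupation {T : X → X} (hT : Measurable T) {A : Set X} (hA : MeasurableSet A)
    (n : ℕ) : Measurable (occupation T A n) := by
  unfold occupation
  exact Finset.measurable_fun_sum _ fun k _ =>
    (measurable_const.indicator hA).comp (hT.iterate k)

/-- The integrals `∫_A S_n(1_A)^p dm` are those of integrable functions. -/
theorem integrableOn_occupation_pow {T : X → X} (hT : Measurable T) {m : Measure X} {A : Set X}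
    (hA : MeasurableSet A) (hm : m A < ∞) (n p : ℕ) :
    IntegrableOn (fun x => occupation T A n x ^ p) A m := by
  refine Measure.integrableOn_of_bounded (M := (n : ℝ) ^ p) hm.ne
    ((measurable_occupation hT hA n).pow_const p).aestronglyMeasurable (ae_of_all _ fun x => ?_)
  rw [Real.norm_of_nonneg (pow_nonneg (occupation_nonneg T A n x) p)]
  exact pow_le_pow_left₀ (occupation_nonneg T A n x) (occupation_le T A n x) p

theorem summable_exp_mul_pow {l : ℝ} (hl : 0 < l) (p : ℕ) :
    Summable fun n : ℕ => Real.exp (-l * n) * (n : ℝ) ^ p := by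
  have h := Real.summable_pow_mul_exp_neg_nat_mul p hl
  exact h.congr fun n => mul_comm _ _

/-- The series defining `u_A(l)` converges for every `l > 0`. -/
theorem summable_returnLaplace (T : X → X) {m : Measure X} {A : Set X} (hm : m A < ∞) {l : ℝ}
    (hl : 0 < l) :
    Summable fun n : ℕ => Real.exp (-l * n) * (m.real (A ∩ T^[n] ⁻¹' A) / m.real A ^ 2) := by
  refine Summable.of_nonneg_of_le (fun n => by positivity) (fun n => ?_)
    ((summable_exp_mul_pow hl 0).mul_right (m.real A / m.real A ^ 2))
  rw [pow_zero, mul_one]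
  gcongr
  · exact hm.ne
  · exact Set.inter_subset_left

/-- The Laplace series of the moments converges for every `l > 0`. -/
theorem summable_momentLaplace (T : X → X) {m : Measure X} {A : Set X} (hm : m A < ∞) (p : ℕ)
    {l : ℝ} (hl : 0 < l) :
    Summable fun n : ℕ => Real.exp (-l * n) * ∫ x in A, occupation T A n x ^ p ∂m := by
  refine Summable.of_nonneg_of_le (fun n => mul_nonneg (Real.exp_pos _).le
    (integral_nonneg fun x => pow_nonneg (occupation_nonneg T A n x) p)) (fun n => ?_)
    ((summable_exp_mul_pow hl p).mul_right (m.real A))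
  rw [mul_assoc]
  refine mul_le_mul_of_nonneg_left ?_ (Real.exp_pos _).le
  refine (Real.le_norm_self _).trans (norm_setIntegral_le_of_norm_le_const hm fun x _ => ?_)
  rw [Real.norm_of_nonneg (pow_nonneg (occupation_nonneg T A n x) p)]
  exact pow_le_pow_left₀ (occupation_nonneg T A n x) (occupation_le T A n x) p

end MomentSets

/-! Put `z = e^{-l}`, and write `W_q` for `dualMoment`, `V_q` for `visitMoment`, `J_q` for
`momentIntegral`. Counting ordered tuples of visits with repetition shows that, at each point, the
generating function of `multichoose (S_n) q` is `V_q` times `z / (1 - z)`. Duality gives `∫_A W_p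
V_q dm = J_{p+q}`, so the Laplace transforms of the rising factorial moments are `q! J_q z / (1 -
z)`. Powers differ from rising factorials by terms of lower order.

It remains to show `J_q ~ m(A) c^q`, where `c = J_1 / m(A) = m(A) u_A(l)`. Conservativity gives `c →
∞`, which makes lower orders negligible.

Upper bound: on a limited set the supremum of the sums of `T̂ᵏ 1_A` is asymptotic to their mean.
Abel summation gives `W_1 ≤ K c` on `A` for any `K > 1` and small `l`, and positivity iterates this
to `W_q ≤ (K c)^q`.

Lower bound, by induction on `q`: `W_q` has an upper bound close to `c^q` and mean close to `c^q`,
hence is close to `c^q` in `L¹(m_A)`. In `J_{q+1} = ∫_A W_q V_1 dm` it may be replaced by `c^q`: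
`V_1` need not be bounded, but `V_1² ≤ 2 V_2` bounds its second moment by `2 J_2 = O(c²)`, so large
values of `V_1` can be truncated. -/

namespace MomentSets

/-! ### Resolvents, duality and the basic inequalities for `J_q` -/

section Operators

variable {X : Type*} [MeasurableSpace X]

/-- Duality between the transfer operator and composition with `T`. -/
theorem lintegral_transfer_mul {T : X → X} {m : Measure X} [SigmaFinite m]
    (hT : Measure.QuasiMeasurePreserving T m m) {f g : X → ℝ≥0∞} (hf : Measurable f)
    (hg : Measurable g) :
    ∫⁻ x, transfer T m f x * g x ∂m = ∫⁻ x, f x * g (T x) ∂m := by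
  have hac : (m.withDensity f).map T ≪ m :=
    ((withDensity_absolutelyContinuous m f).map hT.measurable).trans hT.absolutelyContinuous
  have h := Measure.withDensity_rnDeriv_eq _ _ hac
  calc ∫⁻ x, transfer T m f x * g x ∂m
      = ∫⁻ x, g x ∂(m.withDensity (transfer T m f)) :=
        (lintegral_withDensity_eq_lintegral_mul m (measurable_transfer T m f) hg).symm
    _ = ∫⁻ x, g x ∂((m.withDensity f).map T) := by rw [transfer, h]
    _ = ∫⁻ x, g (T x) ∂(m.withDensity f) := lintegral_map hg hT.measurable
    _ = ∫⁻ x, f x * g (T x) ∂m :=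
        lintegral_withDensity_eq_lintegral_mul m hf (hg.comp hT.measurable)

theorem measurable_iterate_transfer (T : X → X) (m : Measure X) {f : X → ℝ≥0∞}
    (hf : Measurable f) (n : ℕ) : Measurable ((transfer T m)^[n] f) := by
  cases n with
  | zero => exact hf
  | succ n => rw [Function.iterate_succ_apply']; exact measurable_transfer _ _ _

theorem lintegral_iterate_transfer_mul {T : X → X} {m : Measure X} [SigmaFinite m]
    (hT : Measure.QuasiMeasurePreserving T m m) {f g : X → ℝ≥0∞} (hf : Measurable f)
    (hg : Measurable g) (n : ℕ) :
    ∫⁻ x, (transfer T m)^[n] f x * g x ∂m = ∫⁻ x, f x * g (T^[n] x) ∂m := by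
  induction n generalizing g with
  | zero => rfl
  | succ n ih =>
    rw [Function.iterate_succ_apply',
      lintegral_transfer_mul hT (measurable_iterate_transfer T m hf n) hg,
      ih (g := fun x => g (T x)) (hg.comp hT.measurable)]
    simp only [← Function.iterate_succ_apply']

/-- The resolvent `∑ zⁿ T̂ⁿ f` of the transfer operator. -/
noncomputable def resolvent (T : X → X) (m : Measure X) (z : ℝ≥0∞) (f : X → ℝ≥0∞) (x : X) :
    ℝ≥0∞ :=
  ∑' n : ℕ, z ^ n * (transfer T m)^[n] f x

/-- The resolvent `∑ zⁿ g ∘ Tⁿ` of the composition operator. -/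
noncomputable def koopmanResolvent (T : X → X) (z : ℝ≥0∞) (g : X → ℝ≥0∞) (x : X) : ℝ≥0∞ :=
  ∑' n : ℕ, z ^ n * g (T^[n] x)

theorem measurable_resolvent (T : X → X) (m : Measure X) (z : ℝ≥0∞) {f : X → ℝ≥0∞}
    (hf : Measurable f) : Measurable (resolvent T m z f) :=
  Measurable.tsum fun n => (measurable_iterate_transfer T m hf n).const_mul _

theorem measurable_koopmanResolvent {T : X → X} (hT : Measurable T) (z : ℝ≥0∞)
    {g : X → ℝ≥0∞} (hg : Measurable g) : Measurable (koopmanResolvent T z g) :=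
  Measurable.tsum fun n => (hg.comp (hT.iterate n)).const_mul _

theorem lintegral_resolvent_mul {T : X → X} {m : Measure X} [SigmaFinite m]
    (hT : Measure.QuasiMeasurePreserving T m m) (z : ℝ≥0∞) {f g : X → ℝ≥0∞}
    (hf : Measurable f) (hg : Measurable g) :
    ∫⁻ x, resolvent T m z f x * g x ∂m = ∫⁻ x, f x * koopmanResolvent T z g x ∂m := by
  simp only [resolvent, koopmanResolvent, ← ENNReal.tsum_mul_right, ← ENNReal.tsum_mul_left]
  rw [lintegral_tsum (f := fun n x => z ^ n * (transfer T m)^[n] f x * g x) fun n =>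
      (((measurable_iterate_transfer T m hf n).const_mul _).mul hg).aemeasurable,
    lintegral_tsum (f := fun n x => f x * (z ^ n * g (T^[n] x))) fun n =>
      (hf.mul ((hg.comp (hT.measurable.iterate n)).const_mul _)).aemeasurable]
  refine tsum_congr fun n => ?_
  simp only [mul_assoc, mul_left_comm (f _)]
  rw [lintegral_const_mul (f := fun x => (transfer T m)^[n] f x * g x) _
      ((measurable_iterate_transfer T m hf n).mul hg),
    lintegral_const_mul (f := fun x => f x * g (T^[n] x)) _
      (hf.mul (hg.comp (hT.measurable.iterate n))),
    lintegral_iterate_transfer_mul hT hf hg]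

theorem lintegral_indicator_one_mul {m : Measure X} {B : Set X} (hB : MeasurableSet B)
    (f : X → ℝ≥0∞) : ∫⁻ x, f x * B.indicator 1 x ∂m = ∫⁻ x in B, f x ∂m := by
  rw [← lintegral_indicator hB]
  congr 1; ext x
  by_cases h : x ∈ B <;> simp [h]

/-- The transfer operator is only determined almost everywhere, so positivity is obtained by
integrating over sets and passing to the pointwise resolvent of the composition operator. -/
theorem resolvent_le_mul {T : X → X} {m : Measure X} [SigmaFinite m]
    (hT : Measure.QuasiMeasurePreserving T m m) (z : ℝ≥0∞) {f g : X → ℝ≥0∞}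
    (hf : Measurable f) (hg : Measurable g) (c : ℝ≥0∞) (h : ∀ᵐ x ∂m, f x ≤ c * g x) :
    ∀ᵐ x ∂m, resolvent T m z f x ≤ c * resolvent T m z g x := by
  refine ae_le_of_forall_setLIntegral_le_of_sigmaFinite (measurable_resolvent T m z hf)
    fun B hB _ => ?_
  have h1 : Measurable (B.indicator (1 : X → ℝ≥0∞)) := measurable_one.indicator hB
  rw [lintegral_const_mul _ (measurable_resolvent T m z hg), ← lintegral_indicator_one_mul hB,
    ← lintegral_indicator_one_mul hB, lintegral_resolvent_mul hT z hf h1,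
    lintegral_resolvent_mul hT z hg h1,
    ← lintegral_const_mul (f := fun x => g x * koopmanResolvent T z (B.indicator 1) x) _
      (hg.mul (measurable_koopmanResolvent hT.measurable z h1))]
  refine lintegral_mono_ae (h.mono fun x hx => ?_)
  rw [← mul_assoc]
  gcongr

theorem iterate_transfer_indicator_le_one {T : X → X} {m : Measure X} [SigmaFinite m]
    (hT : MeasurePreserving T m m) {A : Set X} (hA : MeasurableSet A) (n : ℕ) :
    ∀ᵐ x ∂m, (transfer T m)^[n] (A.indicator 1) x ≤ 1 := by
  have hA1 : Measurable (A.indicator (1 : X → ℝ≥0∞)) := measurable_one.indicator hA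
  refine ae_le_of_forall_setLIntegral_le_of_sigmaFinite (measurable_iterate_transfer T m hA1 n)
    fun B hB _ => ?_
  have h1 : Measurable (B.indicator (1 : X → ℝ≥0∞)) := measurable_one.indicator hB
  rw [← lintegral_indicator_one_mul hB, lintegral_iterate_transfer_mul hT.quasiMeasurePreserving
    hA1 h1, lintegral_one, Measure.restrict_apply_univ]
  calc ∫⁻ x, A.indicator 1 x * B.indicator 1 (T^[n] x) ∂m
      ≤ ∫⁻ x, B.indicator 1 (T^[n] x) ∂m := by
        refine lintegral_mono fun x => ?_
        by_cases h : x ∈ A <;> simp [h]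
    _ = ∫⁻ x, B.indicator 1 x ∂m := (hT.iterate n).lintegral_comp h1
    _ = m B := lintegral_indicator_one hB

theorem setLIntegral_iterate_transfer_indicator {T : X → X} {m : Measure X} [SigmaFinite m]
    (hT : Measure.QuasiMeasurePreserving T m m) {A : Set X} (hA : MeasurableSet A) (n : ℕ) :
    ∫⁻ x in A, (transfer T m)^[n] (A.indicator 1) x ∂m = m (A ∩ T^[n] ⁻¹' A) := by
  have hA1 : Measurable (A.indicator (1 : X → ℝ≥0∞)) := measurable_one.indicator hA
  rw [← lintegral_indicator_one_mul hA, lintegral_iterate_transfer_mul hT hA1 hA1,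
    ← lintegral_indicator_one (hA.inter (hT.measurable.iterate n hA))]
  refine lintegral_congr fun x => ?_
  by_cases h : x ∈ A <;> by_cases h' : T^[n] x ∈ A <;> simp [h, h']

/-- Iterates of `f ↦ resolvent (1_A f)` on the constant `1`. -/
noncomputable def dualMoment (T : X → X) (m : Measure X) (A : Set X) (z : ℝ≥0∞) :
    ℕ → X → ℝ≥0∞
  | 0 => 1
  | q + 1 => resolvent T m z (A.indicator (dualMoment T m A z q))

/-- Iterates of `g ↦ koopmanResolvent (1_A g)` on the constant `1`. -/
noncomputable def visitMoment (T : X → X) (A : Set X) (z : ℝ≥0∞) : ℕ → X → ℝ≥0∞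
  | 0 => 1
  | q + 1 => koopmanResolvent T z (A.indicator (visitMoment T A z q))

theorem measurable_dualMoment (T : X → X) (m : Measure X) {A : Set X} (hA : MeasurableSet A)
    (z : ℝ≥0∞) (q : ℕ) : Measurable (dualMoment T m A z q) := by
  induction q with
  | zero => exact measurable_one
  | succ q ih => exact measurable_resolvent T m z (ih.indicator hA)

theorem measurable_visitMoment {T : X → X} (hT : Measurable T) {A : Set X}
    (hA : MeasurableSet A) (z : ℝ≥0∞) (q : ℕ) : Measurable (visitMoment T A z q) := by
  induction q with
  | zero => exact measurable_one
  | succ q ih => exact measurable_koopmanResolvent hT z (ih.indicator hA)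

/-- The integral over `A` of `dualMoment`. -/
noncomputable def momentIntegral (T : X → X) (m : Measure X) (A : Set X) (z : ℝ≥0∞) (q : ℕ) :
    ℝ≥0∞ :=
  ∫⁻ x in A, dualMoment T m A z q x ∂m

/-- Each use of duality moves one resolvent from the `V` factor to the `W` factor, so only the total
order matters. -/
theorem setLIntegral_dualMoment_mul_visitMoment {T : X → X} {m : Measure X} [SigmaFinite m]
    (hT : Measure.QuasiMeasurePreserving T m m) {A : Set X} (hA : MeasurableSet A) (z : ℝ≥0∞)
    (p q : ℕ) :
    ∫⁻ x in A, dualMoment T m A z p x * visitMoment T A z q x ∂m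
      = momentIntegral T m A z (p + q) := by
  induction q generalizing p with
  | zero => simp [visitMoment, momentIntegral]
  | succ q ih =>
    have hW := (measurable_dualMoment T m hA z p).indicator hA
    have hV := (measurable_visitMoment hT.measurable hA z q).indicator hA
    rw [show p + (q + 1) = (p + 1) + q by ring, ← ih (p + 1), ← lintegral_indicator hA,
      ← lintegral_indicator hA]
    refine Eq.trans ?_ ((lintegral_resolvent_mul hT z hW hV).symm.trans ?_) <;>
    · refine lintegral_congr fun x => ?_
      by_cases h : x ∈ A <;> simp [h, dualMoment, visitMoment]

theorem setLIntegral_visitMoment {T : X → X} {m : Measure X} [SigmaFinite m]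
    (hT : Measure.QuasiMeasurePreserving T m m) {A : Set X} (hA : MeasurableSet A) (z : ℝ≥0∞)
    (q : ℕ) : ∫⁻ x in A, visitMoment T A z q x ∂m = momentIntegral T m A z q := by
  simpa [dualMoment] using setLIntegral_dualMoment_mul_visitMoment hT hA z 0 q

theorem tsum_ite_le (f : ℕ → ℝ≥0∞) (k : ℕ) :
    ∑' n, (if k ≤ n then f n else 0) = ∑' j, f (k + j) := by
  rw [← (add_right_injective k).tsum_eq]
  · simp
  · intro n hn
    have : k ≤ n := by by_contra h; simp [h] at hn
    exact ⟨n - k, by simp [this]⟩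

theorem tsum_sum_range_succ (f : ℕ → ℕ → ℝ≥0∞) :
    ∑' n, ∑ k ∈ Finset.range (n + 1), f n k = ∑' k, ∑' j, f (k + j) k := by
  rw [tsum_congr fun k => (tsum_ite_le (fun n => f n k) k).symm, ENNReal.tsum_comm]
  refine tsum_congr fun n => ?_
  rw [tsum_eq_sum (s := Finset.range (n + 1))]
  · refine Finset.sum_congr rfl fun k hk => ?_
    rw [if_pos (Nat.lt_succ_iff.1 (Finset.mem_range.1 hk))]
  · intro k hk
    rw [if_neg (fun h => hk (Finset.mem_range.2 (Nat.lt_succ_of_le h)))]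

/-- The double sum splits into the halves `j ≤ k` and `k ≤ j`, equal by symmetry; the diagonal is
counted twice. -/
theorem tsum_sq_le (f : ℕ → ℝ≥0∞) :
    (∑' j, f j) ^ 2 ≤ 2 * ∑' j, f j * ∑' i, f (j + i) := by
  have key : ∑' j, ∑' k, (if j ≤ k then f j * f k else 0) = ∑' j, f j * ∑' i, f (j + i) :=
    tsum_congr fun j => by rw [tsum_ite_le (fun k => f j * f k), ENNReal.tsum_mul_left]
  calc (∑' j, f j) ^ 2 = ∑' j, ∑' k, f j * f k := by
        rw [sq, ← ENNReal.tsum_mul_right]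
        exact tsum_congr fun j => ENNReal.tsum_mul_left.symm
    _ ≤ ∑' j, ∑' k, ((if j ≤ k then f j * f k else 0) + (if k ≤ j then f k * f j else 0)) := by
        refine ENNReal.tsum_le_tsum fun j => ENNReal.tsum_le_tsum fun k => ?_
        rcases le_total j k with h | h
        · simp [h]
        · simp [h, mul_comm]
    _ = 2 * ∑' j, f j * ∑' i, f (j + i) := by
        simp_rw [ENNReal.tsum_add]
        rw [ENNReal.tsum_comm (f := fun j k => if k ≤ j then f k * f j else 0), key, two_mul]

/-- The square counts pairs of visits at times `j ≤ j + i` with weight `z^j z^(j+i)`, whereas `V_2`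
gives them the larger weight `z^j z^i`. This controls the second moment of `V_1`. -/
theorem visitMoment_one_sq_le {Y : Type*} (T : Y → Y) (A : Set Y) {z : ℝ≥0∞} (hz : z ≤ 1)
    (x : Y) :
    visitMoment T A z 1 x ^ 2 ≤ 2 * visitMoment T A z 2 x := by
  have h1 : visitMoment T A z 1 x = ∑' n, z ^ n * A.indicator 1 (T^[n] x) := rfl
  rw [h1]
  refine (tsum_sq_le _).trans ?_
  change _ ≤ 2 * ∑' n, z ^ n * A.indicator (visitMoment T A z 1) (T^[n] x)
  refine mul_le_mul_right (ENNReal.tsum_le_tsum fun j => ?_) _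
  by_cases h : T^[j] x ∈ A
  · simp only [h, Set.indicator_of_mem, Pi.one_apply, mul_one]
    refine mul_le_mul_right ?_ _
    change _ ≤ ∑' n, z ^ n * A.indicator 1 (T^[n] (T^[j] x))
    refine ENNReal.tsum_le_tsum fun i => ?_
    rw [← Function.iterate_add_apply, add_comm i j]
    exact mul_le_mul_left (pow_le_pow_right_of_le_one' hz (Nat.le_add_left i j)) _
  · simp [h]

theorem dualMoment_le_pow {T : X → X} {m : Measure X} [SigmaFinite m]
    (hT : Measure.QuasiMeasurePreserving T m m) {A : Set X} (hA : MeasurableSet A)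
    {z B : ℝ≥0∞} (hB : ∀ᵐ x ∂m, x ∈ A → dualMoment T m A z 1 x ≤ B) (q : ℕ) :
    ∀ᵐ x ∂m, x ∈ A → dualMoment T m A z q x ≤ B ^ q := by
  induction q with
  | zero => exact ae_of_all _ fun x _ => by simp [dualMoment]
  | succ q ih =>
    have h := resolvent_le_mul hT z ((measurable_dualMoment T m hA z q).indicator hA)
      (g := A.indicator 1) (measurable_one.indicator hA) (B ^ q) (ih.mono fun x hx => by
        by_cases h : x ∈ A
        · simpa [h] using hx h
        · simp [h])
    filter_upwards [h, hB] with x h1 h2 hx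
    rw [pow_succ]
    exact h1.trans (by gcongr; exact h2 hx)

theorem momentIntegral_le {T : X → X} {m : Measure X} [SigmaFinite m]
    (hT : Measure.QuasiMeasurePreserving T m m) {A : Set X} (hA : MeasurableSet A)
    {z B : ℝ≥0∞} (hB : ∀ᵐ x ∂m, x ∈ A → dualMoment T m A z 1 x ≤ B) (q : ℕ) :
    momentIntegral T m A z q ≤ B ^ q * m A := by
  rw [← setLIntegral_const]
  exact setLIntegral_mono_ae measurable_const.aemeasurable (dualMoment_le_pow hT hA hB q)

/-- A lower bound for `momentIntegral` of order `q + 1`, in terms of that of order `q`. -/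
theorem le_momentIntegral_succ {T : X → X} {m : Measure X} [SigmaFinite m]
    (hT : Measure.QuasiMeasurePreserving T m m) {A : Set X} (hA : MeasurableSet A)
    {z B c t : ℝ≥0∞} (hz : z ≤ 1) (hcB : c ≤ B)
    (hB : ∀ᵐ x ∂m, x ∈ A → dualMoment T m A z 1 x ≤ B) (q : ℕ) (hJ : B ^ q * m A ≠ ∞)
    (ht0 : t ≠ 0) (ht : t ≠ ∞) :
    c ^ q * momentIntegral T m A z 1 ≤ momentIntegral T m A z (q + 1)
      + t * (B ^ q * m A - momentIntegral T m A z q) + c ^ q / t * (2 * (B ^ 2 * m A)) := by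
  have mW := measurable_dualMoment T m hA z q
  have mV := measurable_visitMoment hT.measurable hA z
  have hsub : ∫⁻ x in A, (B ^ q - dualMoment T m A z q x) ∂m
      = B ^ q * m A - momentIntegral T m A z q := by
    rw [lintegral_sub mW ((momentIntegral_le hT hA hB q).trans_lt hJ.lt_top).ne
      ((ae_restrict_iff' hA).2 (dualMoment_le_pow hT hA hB q)), setLIntegral_const]
    rfl
  have hsq : ∫⁻ x in A, visitMoment T A z 1 x ^ 2 ∂m ≤ 2 * (B ^ 2 * m A) := by
    refine (lintegral_mono fun x => visitMoment_one_sq_le T A hz x).trans ?_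
    rw [lintegral_const_mul _ (mV 2), setLIntegral_visitMoment hT hA]
    gcongr
    exact momentIntegral_le hT hA hB 2
  rw [← hsub, ← setLIntegral_visitMoment hT hA, ← setLIntegral_dualMoment_mul_visitMoment hT hA,
    ← lintegral_const_mul _ (mV 1),
    ← lintegral_const_mul (f := fun x => B ^ q - dualMoment T m A z q x) _
      (measurable_const.sub mW)]
  refine le_trans ?_ (add_le_add_right (mul_le_mul_right hsq _) _)
  rw [← lintegral_const_mul _ ((mV 1).pow_const 2),
    ← lintegral_add_left (f := fun x => dualMoment T m A z q x * visitMoment T A z 1 x)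
      (mW.mul (mV 1)),
    ← lintegral_add_right _ (((mV 1).pow_const 2).const_mul _)]
  refine lintegral_mono fun x => ?_
  set v := visitMoment T A z 1 x
  set w := dualMoment T m A z q x
  have hcw : c ^ q ≤ w + (c ^ q - w) := le_add_tsub
  -- Truncation of `v` at level `t`: below it `c ≤ B` gives the first term, above it `v ≤ v² / t`
  -- gives the second.
  have h1 : (c ^ q - w) * v ≤ t * (B ^ q - w) + c ^ q / t * v ^ 2 := by
    rcases le_total v t with h | h
    · refine le_trans ?_ le_self_add
      rw [mul_comm]
      gcongr
    · refine le_trans ?_ le_add_self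
      rw [div_eq_mul_inv, mul_assoc, sq, ← mul_assoc t⁻¹]
      refine mul_le_mul' tsub_le_self (le_mul_of_one_le_left' ?_)
      rw [← ENNReal.inv_mul_cancel ht0 ht]
      gcongr
  calc c ^ q * v ≤ (w + (c ^ q - w)) * v := by gcongr
    _ = w * v + (c ^ q - w) * v := add_mul _ _ _
    _ ≤ w * v + (t * (B ^ q - w) + c ^ q / t * v ^ 2) := by gcongr
    _ = _ := (add_assoc _ _ _).symm

end Operators

/-! ### Divergence of `J_1`, and the bound on the resolvent over a limited set -/

section Growth

variable {X : Type*} [MeasurableSpace X]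

/-- Abel summation: transfers bounds on partial sums to bounds on power series. -/
theorem tsum_pow_mul_eq_abel {z : ℝ≥0∞} (hz : z < 1) (p : ℕ → ℝ≥0∞) :
    ∑' k, z ^ k * p k = (1 - z) * ∑' n, z ^ n * ∑ k ∈ Finset.range (n + 1), p k := by
  have h : ∀ k, ∑' j, z ^ (k + j) * p k = z ^ k * p k * (1 - z)⁻¹ := fun k => by
    rw [← ENNReal.tsum_geometric, ← ENNReal.tsum_mul_left]
    exact tsum_congr fun j => by rw [pow_add]; ring
  simp_rw [Finset.mul_sum]
  rw [tsum_sum_range_succ fun n k => z ^ n * p k]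
  simp_rw [h]
  rw [ENNReal.tsum_mul_right, mul_comm, mul_assoc, ENNReal.inv_mul_cancel, mul_one]
  · exact (tsub_pos_of_lt hz).ne'
  · exact (tsub_le_self.trans_lt ENNReal.one_lt_top).ne

theorem momentIntegral_one {T : X → X} {m : Measure X} [SigmaFinite m]
    (hT : Measure.QuasiMeasurePreserving T m m) {A : Set X} (hA : MeasurableSet A) (z : ℝ≥0∞) :
    momentIntegral T m A z 1 = ∑' n, z ^ n * m (A ∩ T^[n] ⁻¹' A) := by
  have hA1 : Measurable (A.indicator (1 : X → ℝ≥0∞)) := measurable_one.indicator hA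
  simp only [momentIntegral, dualMoment, resolvent]
  rw [lintegral_tsum fun n =>
    ((measurable_iterate_transfer T m hA1 n).const_mul _).aemeasurable]
  refine tsum_congr fun n => ?_
  rw [lintegral_const_mul _ (measurable_iterate_transfer T m hA1 n),
    setLIntegral_iterate_transfer_indicator hT hA]

theorem momentIntegral_one_ne_top {T : X → X} {m : Measure X} [SigmaFinite m]
    (hT : Measure.QuasiMeasurePreserving T m m) {A : Set X} (hA : MeasurableSet A)
    (hm : m A ≠ ∞) {z : ℝ≥0∞} (hz : z < 1) : momentIntegral T m A z 1 ≠ ∞ := by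
  rw [momentIntegral_one hT hA]
  refine ne_top_of_le_ne_top (b := (1 - z)⁻¹ * m A) (ENNReal.mul_ne_top ?_ hm) ?_
  · exact ENNReal.inv_ne_top.2 (tsub_pos_of_lt hz).ne'
  · rw [← ENNReal.tsum_geometric, ← ENNReal.tsum_mul_right]
    gcongr
    exact Set.inter_subset_left

/-- A set of positive measure is visited infinitely often in the mean. -/
theorem tsum_measure_inter_preimage_eq_top {T : X → X} {m : Measure X}
    (hT : Conservative T m) {A : Set X} (hA : MeasurableSet A) (hm : m A ≠ 0) :
    ∑' n, m (A ∩ T^[n] ⁻¹' A) = ∞ := by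
  have hme : ∀ n, MeasurableSet (A ∩ T^[n] ⁻¹' A) := fun n =>
    hA.inter (hT.measurable.iterate n hA)
  by_contra h
  -- Borel–Cantelli, against the infinite recurrence of almost every point of `A`.
  have h0 : m (limsup (fun n => A ∩ T^[n] ⁻¹' A) atTop) = 0 := measure_limsup_atTop_eq_zero h
  refine hm ((measure_mono_null_ae ?_ ) h0)
  filter_upwards [hT.ae_mem_imp_frequently_image_mem hA.nullMeasurableSet] with x hx hxA
  exact mem_limsup_iff_frequently_mem.2 ((hx hxA).mono fun n hn => ⟨hxA, hn⟩)

/-- On a limited set, the sums of `T̂ᵏ 1_A` are eventually bounded by their means on `A`, up to a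
factor close to `1`. -/
theorem IsLimitedSet.eventually_sum_le {T : X → X} {m : Measure X} [SigmaFinite m]
    (hT : Measure.QuasiMeasurePreserving T m m) {A : Set X} (hA : IsLimitedSet T m A)
    {K : ℝ} (hK : 1 < K) :
    ∀ᶠ n in atTop, ∀ᵐ x ∂m, x ∈ A →
      (∑ k ∈ Finset.range n, (transfer T m)^[k] (A.indicator 1) x) * m A
        ≤ ENNReal.ofReal K * ∑ k ∈ Finset.range n, m (A ∩ T^[k] ⁻¹' A) := by
  obtain ⟨hAm, h0, htop, a, ha, hmeas, hsup⟩ := hA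
  have hA1 : Measurable (A.indicator (1 : X → ℝ≥0∞)) := measurable_one.indicator hAm
  set M := m.real A with hM
  have hM0 : 0 < M := ENNReal.toReal_pos h0.ne' htop.ne
  have hMA : m A = ENNReal.ofReal M := (ENNReal.ofReal_toReal htop.ne).symm
  -- The sums are at most `(M + η) a_n` on `A`, and at least `(M - η) a_n` on a part of `A` of
  -- measure at least `(1 - η) M`; comparing the two eliminates `a_n`.
  obtain ⟨η, hη0, hη1, hηM, hη⟩ : ∃ η : ℝ, 0 < η ∧ η < 1 ∧ η < M ∧
      M + η < K * ((M - η) * (1 - η)) := by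
    have hc : Tendsto (fun η : ℝ => K * ((M - η) * (1 - η)) - (M + η)) (𝓝[>] 0)
        (𝓝 (K * ((M - 0) * (1 - 0)) - (M + 0))) :=
      (Continuous.tendsto (by fun_prop) 0).mono_left nhdsWithin_le_nhds
    have hpos : 0 < K * ((M - 0) * (1 - 0)) - (M + 0) := by nlinarith
    obtain ⟨η, h1, h2, h3⟩ := ((hc.eventually (lt_mem_nhds hpos)).and
      (Ioo_mem_nhdsGT (lt_min one_pos hM0))).exists
    exact ⟨η, h2, h3.trans_le (min_le_left _ _), h3.trans_le (min_le_right _ _), by linarith⟩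
  have hev1 : ∀ᶠ n in atTop, essSup (dualAverage T m a (A.indicator 1) n) (m.restrict A)
      < ENNReal.ofReal (M + η) := by
    refine hsup.eventually (gt_mem_nhds ?_)
    rw [hMA]
    exact (ENNReal.ofReal_lt_ofReal_iff (by linarith)).2 (by linarith)
  have hev2 := (tendstoInMeasure_iff_dist.1 hmeas η hη0).eventually
    (gt_mem_nhds (ENNReal.ofReal_pos.2 hη0))
  filter_upwards [hev1, hev2, eventually_ge_atTop 1] with n h1 h2 hn
  set s : X → ℝ≥0∞ := fun x => ∑ k ∈ Finset.range n, (transfer T m)^[k] (A.indicator 1) x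
  have hsm : Measurable s := Finset.measurable_fun_sum _ fun k _ =>
    measurable_iterate_transfer T m hA1 k
  have hint : ∫⁻ x in A, s x ∂m = ∑ k ∈ Finset.range n, m (A ∩ T^[k] ⁻¹' A) := by
    rw [lintegral_finsetSum _ fun k _ => measurable_iterate_transfer T m hA1 k]
    exact Finset.sum_congr rfl fun k _ => setLIntegral_iterate_transfer_indicator hT hAm k
  have ha0 : ENNReal.ofReal (a n) ≠ 0 := (ENNReal.ofReal_pos.2 (ha n hn)).ne'
  have hd : ∀ x, dualAverage T m a (A.indicator 1) n x * ENNReal.ofReal (a n) = s x := fun x =>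
    ENNReal.div_mul_cancel ha0 ENNReal.ofReal_ne_top
  set G : Set X := {x | η ≤ dist (dualAverage T m a (A.indicator 1) n x).toReal M} with hG
  have hdm : Measurable (dualAverage T m a (A.indicator 1) n) := hsm.div_const _
  have hGm : MeasurableSet G :=
    measurableSet_le measurable_const (hdm.ennreal_toReal.dist measurable_const)
  have hGA : ENNReal.ofReal ((1 - η) * M) ≤ m (A \ G) := by
    have h3 : m (A ∩ G) ≤ ENNReal.ofReal (η * M) := by
      rw [ProbabilityTheory.cond_apply hAm] at h2
      rw [ENNReal.ofReal_mul hη0.le, ← hMA, mul_comm]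
      calc m (A ∩ G) = m A * ((m A)⁻¹ * m (A ∩ G)) := by
            rw [← mul_assoc, ENNReal.mul_inv_cancel h0.ne' htop.ne, one_mul]
        _ ≤ _ := by gcongr
    have h4 : m A = m (A ∩ G) + m (A \ G) := (measure_inter_add_sdiff A hGm).symm
    rw [show (1 - η) * M = M - η * M by ring, ENNReal.ofReal_sub _ (by positivity), ← hMA,
      tsub_le_iff_left, h4]
    gcongr
  have hlow : ENNReal.ofReal ((M - η) * (1 - η) * M * a n)
      ≤ ∑ k ∈ Finset.range n, m (A ∩ T^[k] ⁻¹' A) := by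
    rw [← hint]
    calc ENNReal.ofReal ((M - η) * (1 - η) * M * a n)
        = ENNReal.ofReal (M - η) * ENNReal.ofReal (a n) * ENNReal.ofReal ((1 - η) * M) := by
          rw [← ENNReal.ofReal_mul (by linarith), ← ENNReal.ofReal_mul
            (mul_nonneg (by linarith) (ha n hn).le)]
          congr 1; ring
      _ ≤ ENNReal.ofReal (M - η) * ENNReal.ofReal (a n) * m (A \ G) := by gcongr
      _ = ∫⁻ _ in A \ G, ENNReal.ofReal (M - η) * ENNReal.ofReal (a n) ∂m :=
          (setLIntegral_const _ _).symm
      _ ≤ ∫⁻ x in A \ G, s x ∂m := by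
          refine setLIntegral_mono hsm fun x hx => ?_
          rw [← hd x]
          gcongr
          -- Valid also where the average is `∞`, so its finiteness need not be checked.
          refine (ENNReal.ofReal_le_ofReal ?_).trans ENNReal.ofReal_toReal_le
          have hx2 : dist (dualAverage T m a (A.indicator 1) n x).toReal M < η := not_le.1 hx.2
          rw [Real.dist_eq] at hx2
          linarith [(abs_lt.1 hx2).1]
      _ ≤ ∫⁻ x in A, s x ∂m := lintegral_mono_set Set.sdiff_subset
  have hae := (ae_restrict_iff' hAm).1 (ae_le_essSup
    (f := dualAverage T m a (A.indicator 1) n) (μ := m.restrict A))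
  filter_upwards [hae] with x hx hxA
  change s x * m A ≤ _
  calc s x * m A = dualAverage T m a (A.indicator 1) n x * ENNReal.ofReal (a n) * m A := by
        rw [hd]
    _ ≤ ENNReal.ofReal (M + η) * ENNReal.ofReal (a n) * m A := by
        gcongr
        exact (hx hxA).trans h1.le
    _ = ENNReal.ofReal ((M + η) * a n * M) := by
        rw [hMA, ← ENNReal.ofReal_mul (by linarith), ← ENNReal.ofReal_mul
          (mul_nonneg (by linarith) (ha n hn).le)]
    _ ≤ ENNReal.ofReal (K * ((M - η) * (1 - η) * M * a n)) := by
        refine ENNReal.ofReal_le_ofReal ?_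
        have : 0 < a n * M := mul_pos (ha n hn) hM0
        nlinarith
    _ = ENNReal.ofReal K * ENNReal.ofReal ((M - η) * (1 - η) * M * a n) :=
        ENNReal.ofReal_mul (by linarith)
    _ ≤ _ := by gcongr

theorem tendsto_ofReal_exp_neg :
    Tendsto (fun l : ℝ => ENNReal.ofReal (Real.exp (-l))) (𝓝[>] 0) (𝓝 1) := by
  have h : Tendsto (fun l : ℝ => Real.exp (-l)) (𝓝[>] 0) (𝓝 1) := by
    have := (Real.continuous_exp.comp continuous_neg).tendsto (0 : ℝ)
    simp only [Function.comp, neg_zero, Real.exp_zero] at this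
    exact this.mono_left nhdsWithin_le_nhds
  simpa using ENNReal.tendsto_ofReal h

theorem ofReal_exp_neg_lt_one {l : ℝ} (hl : 0 < l) : ENNReal.ofReal (Real.exp (-l)) < 1 := by
  rw [← ENNReal.ofReal_one]
  exact (ENNReal.ofReal_lt_ofReal_iff one_pos).2 (by simpa using hl)

theorem tendsto_momentIntegral_one {T : X → X} {m : Measure X} [SigmaFinite m]
    (hT : Conservative T m) {A : Set X} (hA : MeasurableSet A) (hm : m A ≠ 0) (hm' : m A ≠ ∞) :
    Tendsto (fun l : ℝ => momentIntegral T m A (ENNReal.ofReal (Real.exp (-l))) 1) (𝓝[>] 0)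
      (𝓝 ∞) := by
  simp_rw [momentIntegral_one hT.toQuasiMeasurePreserving hA]
  refine ENNReal.tendsto_nhds_top_iff_nnreal.2 fun C => ?_
  have h1 := ENNReal.tendsto_nat_tsum fun n => m (A ∩ T^[n] ⁻¹' A)
  rw [tsum_measure_inter_preimage_eq_top hT hA hm] at h1
  obtain ⟨N, hN⟩ := (h1.eventually (lt_mem_nhds (ENNReal.coe_lt_top (r := C)))).exists
  have h2 : Tendsto (fun l : ℝ => ∑ n ∈ Finset.range N,
      ENNReal.ofReal (Real.exp (-l)) ^ n * m (A ∩ T^[n] ⁻¹' A)) (𝓝[>] 0)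
      (𝓝 (∑ n ∈ Finset.range N, 1 ^ n * m (A ∩ T^[n] ⁻¹' A))) :=
    tendsto_finsetSum _ fun n _ => ENNReal.Tendsto.mul_const
      (ENNReal.Tendsto.pow tendsto_ofReal_exp_neg)
      (Or.inr (measure_ne_top_of_subset Set.inter_subset_left hm'))
  simp only [one_pow, one_mul] at h2
  exact (h2.eventually (lt_mem_nhds hN)).mono fun l hl => hl.trans_le (ENNReal.sum_le_tsum _)

/-- On a limited set, the resolvent of `1_A` is eventually bounded by its mean on `A`, up to a
factor close to `1`. -/
theorem IsLimitedSet.eventually_dualMoment_one_le {T : X → X} {m : Measure X} [SigmaFinite m]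
    (hc : Conservative T m) (hT : MeasurePreserving T m m) {A : Set X} (hA : IsLimitedSet T m A)
    {K : ℝ} (hK : 1 < K) :
    ∀ᶠ l in 𝓝[>] (0 : ℝ), ∀ᵐ x ∂m, x ∈ A →
      dualMoment T m A (ENNReal.ofReal (Real.exp (-l))) 1 x ≤ ENNReal.ofReal K *
        (momentIntegral T m A (ENNReal.ofReal (Real.exp (-l))) 1 / m A) := by
  have hq := hT.quasiMeasurePreserving
  obtain ⟨K', hK'1, hK'⟩ := exists_between hK
  obtain ⟨N, hN⟩ := eventually_atTop.1 (hA.eventually_sum_le hq hK'1)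
  obtain ⟨hAm, h0, htop, -⟩ := hA
  -- The `N` initial partial sums, each at most `N`, contribute at most `N² m(A)`. Once `J_1`
  -- exceeds this threshold, the gap `K - K'` absorbs them.
  have hC : ((N : ℝ≥0∞) * N * m A) / ENNReal.ofReal (K - K') < ∞ :=
    ENNReal.div_lt_top (by finiteness) (ENNReal.ofReal_pos.2 (by linarith)).ne'
  filter_upwards [(tendsto_momentIntegral_one hc hAm h0.ne' htop.ne).eventually (lt_mem_nhds hC),
    self_mem_nhdsWithin] with l hl hl0
  have hz := ofReal_exp_neg_lt_one hl0
  set z := ENNReal.ofReal (Real.exp (-l))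
  set J := momentIntegral T m A z 1 with hJ
  have hall : ∀ᵐ x ∂m, ∀ n, (N ≤ n → x ∈ A →
      (∑ k ∈ Finset.range n, (transfer T m)^[k] (A.indicator 1) x) * m A
        ≤ ENNReal.ofReal K' * ∑ k ∈ Finset.range n, m (A ∩ T^[k] ⁻¹' A)) ∧
      (transfer T m)^[n] (A.indicator 1) x ≤ 1 := by
    rw [ae_all_iff]
    intro n
    filter_upwards [iterate_transfer_indicator_le_one hT hAm n,
      (ae_all_iff.2 fun h => hN n h : ∀ᵐ x ∂m, ∀ _ : N ≤ n, _)] with x h1 h2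
    exact ⟨h2, h1⟩
  filter_upwards [hall] with x hx hxA
  have hmain : dualMoment T m A z 1 x * m A ≤ N * N * m A + ENNReal.ofReal K' * J := by
    have e1 : dualMoment T m A z 1 x = (1 - z) * ∑' n, z ^ n *
        ∑ k ∈ Finset.range (n + 1), (transfer T m)^[k] (A.indicator 1) x :=
      tsum_pow_mul_eq_abel hz _
    have e2 : J = (1 - z) * ∑' n, z ^ n * ∑ k ∈ Finset.range (n + 1), m (A ∩ T^[k] ⁻¹' A) := by
      rw [hJ, momentIntegral_one hq hAm, tsum_pow_mul_eq_abel hz]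
    have e3 : ∀ n, z ^ n * (∑ k ∈ Finset.range (n + 1),
          (transfer T m)^[k] (A.indicator 1) x) * m A
        ≤ (if n < N then N * m A else 0) + ENNReal.ofReal K' *
          (z ^ n * ∑ k ∈ Finset.range (n + 1), m (A ∩ T^[k] ⁻¹' A)) := by
      intro n
      split_ifs with h
      · refine le_trans ?_ le_self_add
        gcongr
        calc z ^ n * (∑ k ∈ Finset.range (n + 1), (transfer T m)^[k] (A.indicator 1) x)
            ≤ 1 * ∑ k ∈ Finset.range (n + 1), 1 := by
              gcongr with k
              · exact pow_le_one' hz.le n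
              · exact (hx k).2
          _ = ((n + 1 : ℕ) : ℝ≥0∞) := by simp
          _ ≤ N := by exact_mod_cast h
      · rw [zero_add, mul_assoc, mul_left_comm (ENNReal.ofReal K')]
        exact mul_le_mul_right ((hx (n + 1)).1 (by omega) hxA) _
    have e4 : ∑' n : ℕ, (if n < N then (N : ℝ≥0∞) * m A else 0) = N * N * m A := by
      rw [tsum_eq_sum (s := Finset.range N)]
      · rw [Finset.sum_congr rfl fun n hn => if_pos (Finset.mem_range.1 hn)]
        simp [mul_assoc]
      · intro n hn
        rw [if_neg (fun h => hn (Finset.mem_range.2 h))]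
    rw [e1, e2, mul_assoc, ← ENNReal.tsum_mul_right, mul_left_comm (ENNReal.ofReal K'),
      ← ENNReal.tsum_mul_left (a := ENNReal.ofReal K')]
    calc _ ≤ (1 - z) * (N * N * m A + ∑' n, ENNReal.ofReal K' *
          (z ^ n * ∑ k ∈ Finset.range (n + 1), m (A ∩ T^[k] ⁻¹' A))) := by
          rw [← e4, ← ENNReal.tsum_add]
          gcongr with n
          exact e3 n
      _ ≤ _ := by
          rw [mul_add]
          exact add_le_add_left (mul_le_of_le_one_left' tsub_le_self) _
  rw [← mul_div_assoc, ENNReal.le_div_iff_mul_le (Or.inl h0.ne') (Or.inl htop.ne)]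
  refine hmain.trans ?_
  rw [show K = (K - K') + K' by ring, ENNReal.ofReal_add (by linarith) (by linarith), add_mul]
  refine add_le_add_left ?_ _
  rw [mul_comm (ENNReal.ofReal _)]
  exact (ENNReal.div_le_iff (ENNReal.ofReal_pos.2 (by linarith)).ne' ENNReal.ofReal_ne_top).1 hl.le

end Growth

/-! ### Asymptotics of `J_q` -/

section Limits

variable {X : Type*} [MeasurableSpace X]

/-- The truncation inequality at level `t c`, divided by `c^(q+1)`. The constant `8` bounds `2 K²`
for `K ≤ 2`, so that `t` can be fixed before `K`. -/
theorem le_toReal_momentIntegral_succ {T : X → X} {m : Measure X} [SigmaFinite m]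
    (hT : Measure.QuasiMeasurePreserving T m m) {A : Set X} (hA : MeasurableSet A)
    (hm : m A ≠ ∞) {z : ℝ≥0∞} {K c t : ℝ} (hz : z ≤ 1) (hK : 1 ≤ K) (hK2 : K ≤ 2) (hc : 0 < c)
    (hJ1 : (momentIntegral T m A z 1).toReal = c * m.real A)
    (hB : ∀ᵐ x ∂m, x ∈ A → dualMoment T m A z 1 x ≤ ENNReal.ofReal (K * c)) (q : ℕ)
    (ht : 0 < t) :
    m.real A ≤ (momentIntegral T m A z (q + 1)).toReal / c ^ (q + 1)
      + t * (K ^ q * m.real A - (momentIntegral T m A z q).toReal / c ^ q)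
      + 8 * m.real A / t := by
  have hBm : ∀ p, ENNReal.ofReal (K * c) ^ p * m A ≠ ∞ := fun p => by finiteness
  have hJ : ∀ p, momentIntegral T m A z p ≠ ∞ := fun p =>
    ne_top_of_le_ne_top (hBm p) (momentIntegral_le hT hA hB p)
  have htc : 0 < t * c := by positivity
  have htc' : ENNReal.ofReal (t * c) ≠ 0 := (ENNReal.ofReal_pos.2 htc).ne'
  have h := le_momentIntegral_succ hT hA hz (c := ENNReal.ofReal c) (t := ENNReal.ofReal (t * c))
    (ENNReal.ofReal_le_ofReal (by nlinarith)) hB q (hBm q) htc' ENNReal.ofReal_ne_top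
  have f1 : ENNReal.ofReal (t * c) * (ENNReal.ofReal (K * c) ^ q * m A
      - momentIntegral T m A z q) ≠ ∞ :=
    ENNReal.mul_ne_top ENNReal.ofReal_ne_top (ne_top_of_le_ne_top (hBm q) tsub_le_self)
  have f2 : ENNReal.ofReal c ^ q / ENNReal.ofReal (t * c) *
      (2 * (ENNReal.ofReal (K * c) ^ 2 * m A)) ≠ ∞ :=
    ENNReal.mul_ne_top (ENNReal.div_ne_top (by finiteness) htc') (by finiteness)
  have h' := ENNReal.toReal_mono (ENNReal.add_ne_top.2 ⟨ENNReal.add_ne_top.2 ⟨hJ _, f1⟩, f2⟩) h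
  rw [ENNReal.toReal_add (ENNReal.add_ne_top.2 ⟨hJ _, f1⟩) f2, ENNReal.toReal_add (hJ _) f1,
    ENNReal.toReal_mul, ENNReal.toReal_mul, ENNReal.toReal_mul,
    ENNReal.toReal_sub_of_le (momentIntegral_le hT hA hB q) (hBm q), ENNReal.toReal_div, hJ1] at h'
  simp only [ENNReal.toReal_mul, ENNReal.toReal_pow, ENNReal.toReal_ofReal hc.le,
    ENNReal.toReal_ofReal htc.le, ENNReal.toReal_ofReal (show 0 ≤ K * c by positivity),
    ENNReal.toReal_ofNat] at h'
  change c ^ q * (c * m.real A) ≤ _ + t * c * ((K * c) ^ q * m.real A - _)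
    + c ^ q / (t * c) * (2 * ((K * c) ^ 2 * m.real A)) at h'
  set M := m.real A
  have hM : 0 ≤ M := measureReal_nonneg
  have hlast : c ^ q / (t * c) * (2 * ((K * c) ^ 2 * M)) ≤ 8 * M / t * c ^ (q + 1) := by
    rw [show c ^ q / (t * c) * (2 * ((K * c) ^ 2 * M)) = (2 * K ^ 2) * M / t * c ^ (q + 1) by
      field_simp
      ring]
    gcongr
    nlinarith
  have hcq : 0 < c ^ (q + 1) := by positivity
  rw [← mul_le_mul_iff_left₀ hcq]
  have e : ((momentIntegral T m A z (q + 1)).toReal / c ^ (q + 1)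
      + t * (K ^ q * M - (momentIntegral T m A z q).toReal / c ^ q) + 8 * M / t) * c ^ (q + 1)
      = (momentIntegral T m A z (q + 1)).toReal + t * c * ((K * c) ^ q * M
        - (momentIntegral T m A z q).toReal) + 8 * M / t * c ^ (q + 1) := by
    field_simp
    ring
  rw [e]
  calc M * c ^ (q + 1) = c ^ q * (c * M) := by ring
    _ ≤ _ := h'
    _ ≤ _ := by gcongr

theorem toReal_momentIntegral_le {T : X → X} {m : Measure X} [SigmaFinite m]
    (hT : Measure.QuasiMeasurePreserving T m m) {A : Set X} (hA : MeasurableSet A)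
    (hm : m A ≠ ∞) {z : ℝ≥0∞} {K c : ℝ} (hK : 1 ≤ K) (hc : 0 < c)
    (hB : ∀ᵐ x ∂m, x ∈ A → dualMoment T m A z 1 x ≤ ENNReal.ofReal (K * c)) (q : ℕ) :
    (momentIntegral T m A z q).toReal / c ^ q ≤ K ^ q * m.real A := by
  have h := ENNReal.toReal_mono (by finiteness) (momentIntegral_le hT hA hB q)
  rw [ENNReal.toReal_mul, ENNReal.toReal_pow, ENNReal.toReal_ofReal (by positivity), mul_pow] at h
  rw [div_le_iff₀ (by positivity)]
  exact h.trans_eq (by rw [Measure.real]; ring)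

/-- The normalisation `m(A) u_A(l)`. -/
noncomputable def normalization (T : X → X) (m : Measure X) (A : Set X) (l : ℝ) : ℝ :=
  (momentIntegral T m A (ENNReal.ofReal (Real.exp (-l))) 1).toReal / m.real A

theorem tendsto_normalization {T : X → X} {m : Measure X} [SigmaFinite m]
    (hT : Conservative T m) {A : Set X} (hA : MeasurableSet A) (hm : m A ≠ 0) (hm' : m A ≠ ∞) :
    Tendsto (normalization T m A) (𝓝[>] 0) atTop := by
  refine Tendsto.atTop_div_const (ENNReal.toReal_pos hm hm') ?_
  refine tendsto_atTop.2 fun C => ?_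
  filter_upwards [(tendsto_momentIntegral_one hT hA hm hm').eventually
    (lt_mem_nhds (ENNReal.ofReal_lt_top (r := C))), self_mem_nhdsWithin] with l hl hl0
  have hfin := momentIntegral_one_ne_top hT.toQuasiMeasurePreserving hA hm'
    (ofReal_exp_neg_lt_one hl0)
  exact (ENNReal.ofReal_le_iff_le_toReal hfin).1 hl.le

theorem exists_pow_mul_lt {b M : ℝ} (hM : M < b) (q : ℕ) :
    ∃ K : ℝ, 1 < K ∧ K ≤ 2 ∧ K ^ q * M < b := by
  have h : Tendsto (fun K : ℝ => K ^ q * M) (𝓝[>] 1) (𝓝 (1 ^ q * M)) :=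
    (Continuous.tendsto (by fun_prop) 1).mono_left nhdsWithin_le_nhds
  rw [one_pow, one_mul] at h
  obtain ⟨K, h1, h2, h3⟩ := ((h.eventually (gt_mem_nhds hM)).and
    (Ioc_mem_nhdsGT one_lt_two)).exists
  exact ⟨K, h2, h3, h1⟩

theorem IsLimitedSet.eventually_dualMoment_one_le_normalization {T : X → X} {m : Measure X}
    [SigmaFinite m] (hc : Conservative T m) (hT : MeasurePreserving T m m) {A : Set X}
    (hA : IsLimitedSet T m A) {K : ℝ} (hK : 1 < K) :
    ∀ᶠ l in 𝓝[>] (0 : ℝ), 0 < normalization T m A l ∧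
      (momentIntegral T m A (ENNReal.ofReal (Real.exp (-l))) 1).toReal
        = normalization T m A l * m.real A ∧
      ∀ᵐ x ∂m, x ∈ A → dualMoment T m A (ENNReal.ofReal (Real.exp (-l))) 1 x
        ≤ ENNReal.ofReal (K * normalization T m A l) := by
  have hM : 0 < m.real A := ENNReal.toReal_pos hA.2.1.ne' hA.2.2.1.ne
  filter_upwards [hA.eventually_dualMoment_one_le hc hT hK, self_mem_nhdsWithin,
    (tendsto_normalization hc hA.1 hA.2.1.ne' hA.2.2.1.ne).eventually_gt_atTop 0] with l h hl hpos
  refine ⟨hpos, (div_mul_cancel₀ _ hM.ne').symm, ?_⟩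
  have hfin := momentIntegral_one_ne_top hc.toQuasiMeasurePreserving hA.1 hA.2.2.1.ne
    (ofReal_exp_neg_lt_one hl)
  rw [ENNReal.ofReal_mul (by linarith), normalization, ENNReal.ofReal_div_of_pos hM,
    ENNReal.ofReal_toReal hfin, Measure.real, ENNReal.ofReal_toReal hA.2.2.1.ne]
  exact h

/-- Only the lower bound uses the induction hypothesis: it says that `W_q / c^q` has little room
below its upper bound `K^q`. -/
theorem IsLimitedSet.tendsto_momentIntegral {T : X → X} {m : Measure X} [SigmaFinite m]
    (hc : Conservative T m) (hT : MeasurePreserving T m m) {A : Set X} (hA : IsLimitedSet T m A)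
    (q : ℕ) :
    Tendsto (fun l => (momentIntegral T m A (ENNReal.ofReal (Real.exp (-l))) q).toReal
      / normalization T m A l ^ q) (𝓝[>] 0) (𝓝 (m.real A)) := by
  have hq := hT.quasiMeasurePreserving
  have hAm := hA.1
  have htop := hA.2.2.1.ne
  induction q with
  | zero =>
    simp [momentIntegral, dualMoment, Measure.real]
  | succ q ih =>
    set M := m.real A
    have hM : 0 < M := ENNReal.toReal_pos hA.2.1.ne' htop
    refine tendsto_order.2 ⟨fun a ha => ?_, fun b hb => ?_⟩
    -- With this `t` the truncated tail costs exactly `d`. The choice of `K` and the induction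
    -- hypothesis make the `L¹` gap less than `2 d / t`, which costs less than `2 d`; together less
    -- than `M - a`.
    · set d := (M - a) / 3 with hd
      have hd0 : 0 < d := by simp only [hd]; linarith
      set t := 8 * M / d with ht
      have ht0 : 0 < t := by positivity
      have htd : 8 * M / t = d := by rw [ht]; field_simp
      obtain ⟨K, hK1, hK2, hK⟩ := exists_pow_mul_lt
        (show M < M + d / t by linarith [div_pos hd0 ht0]) q
      filter_upwards [hA.eventually_dualMoment_one_le_normalization hc hT hK1,
        ih.eventually (lt_mem_nhds (show M - d / t < M by linarith [div_pos hd0 ht0])),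
        self_mem_nhdsWithin] with l ⟨hpos, hJ1, hB⟩ hl hl0
      have h := le_toReal_momentIntegral_succ hq hAm htop (ofReal_exp_neg_lt_one hl0).le hK1.le hK2
        hpos hJ1 hB q ht0
      have h2 : t * (K ^ q * M - (momentIntegral T m A (ENNReal.ofReal (Real.exp (-l))) q).toReal
          / normalization T m A l ^ q) < t * (2 * (d / t)) :=
        mul_lt_mul_of_pos_left (by linarith) ht0
      rw [show t * (2 * (d / t)) = 2 * d by field_simp] at h2
      rw [htd] at h
      linarith
    · obtain ⟨K, hK1, -, hK⟩ := exists_pow_mul_lt hb (q + 1)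
      filter_upwards [hA.eventually_dualMoment_one_le_normalization hc hT hK1] with l ⟨hpos, _, hB⟩
      exact (toReal_momentIntegral_le hq hAm htop hK1.le hpos hB (q + 1)).trans_lt hK

end Limits

/-! ### Combinatorics of visits and rising factorials -/

section Visits

variable {X : Type*}

/-- The number of visits to `A` before time `n`. -/
noncomputable def visits (T : X → X) (A : Set X) (n : ℕ) (x : X) : ℕ :=
  ∑ k ∈ Finset.range n, A.indicator (fun _ => 1) (T^[k] x)

theorem occupation_eq_visits (T : X → X) (A : Set X) (n : ℕ) (x : X) :
    occupation T A n x = visits T A n x := by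
  classical
  simp [occupation, visits, Set.indicator_apply]

theorem visits_zero (T : X → X) (A : Set X) (x : X) : visits T A 0 x = 0 := by simp [visits]

theorem visits_succ_of_mem {T : X → X} {A : Set X} {x : X} (hx : x ∈ A) (n : ℕ) :
    visits T A (n + 1) x = visits T A n (T x) + 1 := by
  simp [visits, Finset.sum_range_succ', hx]

theorem visits_succ_of_notMem {T : X → X} {A : Set X} {x : X} (hx : x ∉ A) (n : ℕ) :
    visits T A (n + 1) x = visits T A n (T x) := by
  simp [visits, Finset.sum_range_succ', hx]

/-- Decomposition of the number of multisets of visits according to the first visit. -/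
theorem multichoose_visits_succ (T : X → X) (A : Set X) (q n : ℕ) (x : X) :
    ((visits T A n x).multichoose (q + 1) : ℝ≥0∞) = ∑ k ∈ Finset.range n,
      A.indicator (fun y => ((visits T A (n - k) y).multichoose q : ℝ≥0∞)) (T^[k] x) := by
  induction n generalizing x with
  | zero => simp [visits_zero]
  | succ n ih =>
    rw [Finset.sum_range_succ']
    simp only [Nat.add_sub_add_right, Function.iterate_succ_apply, ← ih, Nat.sub_zero,
      Function.iterate_zero, id]
    by_cases hx : x ∈ A
    · rw [Set.indicator_of_mem hx, visits_succ_of_mem hx, Nat.multichoose_succ_succ]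
      push_cast
      rfl
    · rw [Set.indicator_of_notMem hx, visits_succ_of_notMem hx, add_zero]

/-- Splitting at a visit at time `k` leaves a window of positive length `n + 1 - k`; starting the
series at `n + 1` is therefore stable under the recursion and gives the same factor for every `q`.
-/
theorem tsum_pow_mul_multichoose_visits (T : X → X) (A : Set X) (z : ℝ≥0∞) (q : ℕ) (x : X) :
    ∑' n, z ^ (n + 1) * ((visits T A (n + 1) x).multichoose q : ℝ≥0∞)
      = visitMoment T A z q x * (z * (1 - z)⁻¹) := by
  induction q generalizing x with
  | zero =>
    simp only [Nat.multichoose_zero_right, Nat.cast_one, mul_one, visitMoment, Pi.one_apply,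
      one_mul, pow_succ', ENNReal.tsum_mul_left, ENNReal.tsum_geometric]
  | succ q ih =>
    simp_rw [multichoose_visits_succ, Finset.mul_sum]
    rw [tsum_sum_range_succ fun n k => z ^ (n + 1) *
      A.indicator (fun y => ((visits T A (n + 1 - k) y).multichoose q : ℝ≥0∞)) (T^[k] x)]
    change _ = (∑' k, z ^ k * A.indicator (visitMoment T A z q) (T^[k] x)) * _
    rw [← ENNReal.tsum_mul_right]
    refine tsum_congr fun k => ?_
    by_cases hx : T^[k] x ∈ A
    · simp only [Set.indicator_of_mem hx]
      rw [mul_assoc, ← ih, ← ENNReal.tsum_mul_left]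
      refine tsum_congr fun j => ?_
      rw [show k + j + 1 - k = j + 1 by omega, add_assoc, pow_add, mul_assoc]
    · simp [hx]

theorem pow_le_factorial_mul_multichoose (s p : ℕ) : s ^ p ≤ p.factorial * s.multichoose p := by
  rw [Nat.multichoose_eq, ← Nat.ascFactorial_eq_factorial_mul_choose']
  exact Nat.pow_succ_le_ascFactorial s p

/-- Only the order of the error matters; the constant `r * 2 ^ r` is crude and chosen to close the
induction. -/
theorem ascFactorial_succ_le (s r : ℕ) :
    s.ascFactorial (r + 1) ≤ s ^ (r + 1) + r * 2 ^ r * s.ascFactorial r := by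
  induction r with
  | zero => simp [Nat.ascFactorial]
  | succ r ih =>
    have h1 : s.ascFactorial (r + 2) = (s + (r + 1)) * s.ascFactorial (r + 1) := rfl
    have h2 : s.ascFactorial (r + 1) = (s + r) * s.ascFactorial r := rfl
    have h3 : s ^ (r + 1) ≤ s.ascFactorial (r + 1) := Nat.pow_succ_le_ascFactorial s (r + 1)
    have h4 : r * 2 ^ r * s.ascFactorial r ≤ r * 2 ^ r * s.ascFactorial (r + 1) := by
      rcases Nat.eq_zero_or_pos r with rfl | hr
      · simp
      · rw [h2]
        exact Nat.mul_le_mul_left _ (Nat.le_mul_of_pos_left _ (by omega))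
    have h5 : (r + 1) * s ^ (r + 1) ≤ 2 ^ r * 2 * s.ascFactorial (r + 1) :=
      Nat.mul_le_mul (by rw [← pow_succ]; exact Nat.lt_two_pow_self.le) h3
    calc s.ascFactorial (r + 2)
        ≤ (s + (r + 1)) * (s ^ (r + 1) + r * 2 ^ r * s.ascFactorial r) := by
          rw [h1]; exact Nat.mul_le_mul_left _ ih
      _ = s ^ (r + 2) + (r + 1) * s ^ (r + 1) + r * 2 ^ r * s.ascFactorial (r + 1)
          + r * 2 ^ r * s.ascFactorial r := by rw [h2]; ring
      _ ≤ s ^ (r + 2) + (r + 1) * (2 ^ r * 2 * s.ascFactorial (r + 1)) := by linarith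
      _ = _ := by ring

theorem factorial_mul_multichoose_succ_le (s r : ℕ) :
    (r + 1).factorial * s.multichoose (r + 1)
      ≤ s ^ (r + 1) + r * 2 ^ r * (r.factorial * s.multichoose r) := by
  simp only [Nat.multichoose_eq, ← Nat.ascFactorial_eq_factorial_mul_choose']
  exact ascFactorial_succ_le s r

end Visits

/-! ### From rising factorial moments to power moments -/

section Moments

variable {X : Type*} [MeasurableSpace X]

theorem measurable_visits {T : X → X} (hT : Measurable T) {A : Set X} (hA : MeasurableSet A)
    (n : ℕ) : Measurable (visits T A n) := by
  exact Finset.measurable_fun_sum _ fun k _ =>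
    (measurable_const.indicator hA).comp (hT.iterate k)

theorem tsum_pow_mul_lintegral_multichoose_visits {T : X → X} {m : Measure X} [SigmaFinite m]
    (hT : Measure.QuasiMeasurePreserving T m m) {A : Set X} (hA : MeasurableSet A) (z : ℝ≥0∞)
    (q : ℕ) :
    ∑' n, z ^ (n + 1) * ∫⁻ x in A, ((visits T A (n + 1) x).multichoose q : ℝ≥0∞) ∂m
      = momentIntegral T m A z q * (z * (1 - z)⁻¹) := by
  have hv : ∀ n, Measurable fun x => ((visits T A n x).multichoose q : ℝ≥0∞) := fun n =>
    (measurable_of_countable fun k : ℕ => (k.multichoose q : ℝ≥0∞)).comp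
      (measurable_visits hT.measurable hA n)
  simp_rw [← lintegral_const_mul _ (hv _)]
  rw [← lintegral_tsum fun n => ((hv _).const_mul _).aemeasurable]
  simp_rw [tsum_pow_mul_multichoose_visits]
  rw [lintegral_mul_const _ (measurable_visitMoment hT.measurable hA z q),
    setLIntegral_visitMoment hT hA]

theorem momentLaplace_eq_toReal {T : X → X} {m : Measure X} (hT : Measurable T) {A : Set X}
    (hA : MeasurableSet A) (hm : m A ≠ ∞) {p : ℕ} (hp : p ≠ 0) (l : ℝ) :
    momentLaplace T m A p l = (∑' n, ENNReal.ofReal (Real.exp (-l)) ^ (n + 1) *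
      ∫⁻ x in A, (visits T A (n + 1) x : ℝ≥0∞) ^ p ∂m).toReal := by
  have hI : ∀ n, ENNReal.ofReal (∫ x in A, occupation T A n x ^ p ∂m)
      = ∫⁻ x in A, (visits T A n x : ℝ≥0∞) ^ p ∂m := fun n => by
    rw [ofReal_integral_eq_lintegral_ofReal (integrableOn_occupation_pow hT hA hm.lt_top n p)
      (ae_of_all _ fun x => pow_nonneg (occupation_nonneg T A n x) p)]
    refine lintegral_congr fun x => ?_
    rw [ENNReal.ofReal_pow (occupation_nonneg T A n x), occupation_eq_visits,
      ENNReal.ofReal_natCast]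
  have hterm : ∀ n : ℕ, ENNReal.ofReal (Real.exp (-l)) ^ n *
      ∫⁻ x in A, (visits T A n x : ℝ≥0∞) ^ p ∂m
      = ENNReal.ofReal (Real.exp (-l * n) * ∫ x in A, occupation T A n x ^ p ∂m) := fun n => by
    rw [← hI, ENNReal.ofReal_mul (Real.exp_pos _).le, mul_comm (-l), Real.exp_nat_mul,
      ENNReal.ofReal_pow (Real.exp_pos _).le]
  -- The term `n = 0` vanishes because `p ≠ 0`; for `p = 0` it would be `m(A)`.
  have hshift : ∑' n : ℕ, ENNReal.ofReal (Real.exp (-l)) ^ (n + 1) *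
        ∫⁻ x in A, (visits T A (n + 1) x : ℝ≥0∞) ^ p ∂m
      = ∑' n : ℕ, ENNReal.ofReal (Real.exp (-l)) ^ n *
        ∫⁻ x in A, (visits T A n x : ℝ≥0∞) ^ p ∂m := by
    rw [tsum_eq_zero_add' (f := fun n : ℕ => ENNReal.ofReal (Real.exp (-l)) ^ n *
      ∫⁻ x in A, (visits T A n x : ℝ≥0∞) ^ p ∂m) ENNReal.summable]
    simp [visits_zero, hp]
  rw [hshift]
  simp_rw [hterm]
  rw [ENNReal.tsum_toReal_eq fun n => ENNReal.ofReal_ne_top]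
  refine tsum_congr fun n => (ENNReal.toReal_ofReal ?_).symm
  exact mul_nonneg (Real.exp_pos _).le
    (integral_nonneg fun x => pow_nonneg (occupation_nonneg T A n x) p)

theorem momentLaplace_bounds {T : X → X} {m : Measure X} [SigmaFinite m]
    (hT : Measure.QuasiMeasurePreserving T m m) {A : Set X} (hA : MeasurableSet A) (hm : m A ≠ ∞)
    (r : ℕ) {l : ℝ} (hl : 0 < l)
    (hJ : ∀ q, momentIntegral T m A (ENNReal.ofReal (Real.exp (-l))) q ≠ ∞) :
    momentLaplace T m A (r + 1) l ≤ (r + 1).factorial *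
        ((momentIntegral T m A (ENNReal.ofReal (Real.exp (-l))) (r + 1)).toReal
          * (Real.exp (-l) * (1 - Real.exp (-l))⁻¹)) ∧
      (r + 1).factorial *
        ((momentIntegral T m A (ENNReal.ofReal (Real.exp (-l))) (r + 1)).toReal
          * (Real.exp (-l) * (1 - Real.exp (-l))⁻¹))
      ≤ momentLaplace T m A (r + 1) l + r * 2 ^ r * (r.factorial *
        ((momentIntegral T m A (ENNReal.ofReal (Real.exp (-l))) r).toReal
          * (Real.exp (-l) * (1 - Real.exp (-l))⁻¹))) := by
  have hz := ofReal_exp_neg_lt_one hl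
  rw [momentLaplace_eq_toReal hT.measurable hA hm r.succ_ne_zero]
  have hg : (ENNReal.ofReal (Real.exp (-l)) * (1 - ENNReal.ofReal (Real.exp (-l)))⁻¹).toReal
      = Real.exp (-l) * (1 - Real.exp (-l))⁻¹ := by
    rw [ENNReal.toReal_mul, ENNReal.toReal_inv, ENNReal.toReal_sub_of_le hz.le ENNReal.one_ne_top,
      ENNReal.toReal_ofReal (Real.exp_pos _).le, ENNReal.toReal_one]
  have hgt : ENNReal.ofReal (Real.exp (-l)) * (1 - ENNReal.ofReal (Real.exp (-l)))⁻¹ ≠ ∞ :=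
    ENNReal.mul_ne_top ENNReal.ofReal_ne_top (ENNReal.inv_ne_top.2 (tsub_pos_of_lt hz).ne')
  set z := ENNReal.ofReal (Real.exp (-l))
  have hE := tsum_pow_mul_lintegral_multichoose_visits (m := m) hT hA z
  have hEr : ∀ q, (momentIntegral T m A z q).toReal * (Real.exp (-l) * (1 - Real.exp (-l))⁻¹)
      = (∑' n, z ^ (n + 1) *
        ∫⁻ x in A, ((visits T A (n + 1) x).multichoose q : ℝ≥0∞) ∂m).toReal := fun q => by
    rw [hE, ENNReal.toReal_mul, hg]
  have hEt : ∀ q, ∑' n, z ^ (n + 1) *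
      ∫⁻ x in A, ((visits T A (n + 1) x).multichoose q : ℝ≥0∞) ∂m ≠ ∞ := fun q => by
    rw [hE]; exact ENNReal.mul_ne_top (hJ q) hgt
  have hmc : ∀ q n, Measurable fun x => ((visits T A n x).multichoose q : ℝ≥0∞) := fun q n =>
    (measurable_of_countable fun k : ℕ => (k.multichoose q : ℝ≥0∞)).comp
      (measurable_visits hT.measurable hA n)
  have hmp : ∀ n, Measurable fun x => (visits T A n x : ℝ≥0∞) ^ (r + 1) := fun n =>
    (measurable_of_countable fun k : ℕ => (k : ℝ≥0∞) ^ (r + 1)).comp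
      (measurable_visits hT.measurable hA n)
  have hup : ∑' n, z ^ (n + 1) * ∫⁻ x in A, (visits T A (n + 1) x : ℝ≥0∞) ^ (r + 1) ∂m
      ≤ ((r + 1).factorial : ℝ≥0∞) * ∑' n, z ^ (n + 1) *
        ∫⁻ x in A, ((visits T A (n + 1) x).multichoose (r + 1) : ℝ≥0∞) ∂m := by
    rw [← ENNReal.tsum_mul_left]
    refine ENNReal.tsum_le_tsum fun n => ?_
    rw [mul_left_comm, ← lintegral_const_mul _ (hmc _ _)]
    refine mul_le_mul_right (lintegral_mono fun x => ?_) _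
    have h := (Nat.cast_le (α := ℝ≥0∞)).2
      (pow_le_factorial_mul_multichoose (visits T A (n + 1) x) (r + 1))
    simpa only [Nat.cast_mul, Nat.cast_pow] using h
  have hlow : ((r + 1).factorial : ℝ≥0∞) * ∑' n, z ^ (n + 1) *
        ∫⁻ x in A, ((visits T A (n + 1) x).multichoose (r + 1) : ℝ≥0∞) ∂m
      ≤ ∑' n, z ^ (n + 1) * ∫⁻ x in A, (visits T A (n + 1) x : ℝ≥0∞) ^ (r + 1) ∂m
        + ((r * 2 ^ r * r.factorial : ℕ) : ℝ≥0∞) * ∑' n, z ^ (n + 1) *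
          ∫⁻ x in A, ((visits T A (n + 1) x).multichoose r : ℝ≥0∞) ∂m := by
    rw [← ENNReal.tsum_mul_left, ← ENNReal.tsum_mul_left, ← ENNReal.tsum_add]
    refine ENNReal.tsum_le_tsum fun n => ?_
    rw [mul_left_comm, mul_left_comm (((r * 2 ^ r * r.factorial : ℕ) : ℝ≥0∞)), ← mul_add,
      ← lintegral_const_mul _ (hmc _ _), ← lintegral_const_mul _ (hmc _ _),
      ← lintegral_add_left (hmp _)]
    refine mul_le_mul_right (lintegral_mono fun x => ?_) _
    have h := (Nat.cast_le (α := ℝ≥0∞)).2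
      (factorial_mul_multichoose_succ_le (visits T A (n + 1) x) r)
    rw [← mul_assoc] at h
    simpa only [Nat.cast_mul, Nat.cast_pow, Nat.cast_add] using h
  have hNt := ne_top_of_le_ne_top (ENNReal.mul_ne_top (ENNReal.natCast_ne_top _) (hEt _)) hup
  have hCt := ENNReal.mul_ne_top (ENNReal.natCast_ne_top (r * 2 ^ r * r.factorial)) (hEt r)
  constructor
  · have h := ENNReal.toReal_mono (ENNReal.mul_ne_top (ENNReal.natCast_ne_top _) (hEt _)) hup
    rwa [ENNReal.toReal_mul, ← hEr, ENNReal.toReal_natCast] at h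
  · have h := ENNReal.toReal_mono (ENNReal.add_ne_top.2 ⟨hNt, hCt⟩) hlow
    rw [ENNReal.toReal_add hNt hCt, ENNReal.toReal_mul, ENNReal.toReal_mul, ← hEr, ← hEr,
      ENNReal.toReal_natCast, ENNReal.toReal_natCast] at h
    push_cast at h
    rwa [mul_assoc (_ * _) (r.factorial : ℝ)] at h

theorem momentIntegral_ne_top {T : X → X} {m : Measure X} [SigmaFinite m]
    (hT : Measure.QuasiMeasurePreserving T m m) {A : Set X} (hA : MeasurableSet A) (hm : m A ≠ ∞)
    {z : ℝ≥0∞} {B : ℝ} (hB : ∀ᵐ x ∂m, x ∈ A → dualMoment T m A z 1 x ≤ ENNReal.ofReal B)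
    (q : ℕ) : momentIntegral T m A z q ≠ ∞ :=
  ne_top_of_le_ne_top (by finiteness) (momentIntegral_le hT hA hB q)

theorem normalization_eq {T : X → X} {m : Measure X} [SigmaFinite m]
    (hT : Measure.QuasiMeasurePreserving T m m) {A : Set X} (hA : MeasurableSet A)
    (h0 : m A ≠ 0) (hm : m A ≠ ∞) (l : ℝ) :
    normalization T m A l = m.real A * returnLaplace T m A l := by
  have hM : 0 < m.real A := ENNReal.toReal_pos h0 hm
  rw [normalization, momentIntegral_one hT hA, ENNReal.tsum_toReal_eq fun n =>
    ENNReal.mul_ne_top (by finiteness) (measure_ne_top_of_subset Set.inter_subset_left hm),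
    returnLaplace, ← tsum_mul_left, ← tsum_div_const]
  refine tsum_congr fun n => ?_
  rw [ENNReal.toReal_mul, ENNReal.toReal_pow, ENNReal.toReal_ofReal (Real.exp_pos _).le,
    ← Real.exp_nat_mul, mul_comm (n : ℝ)]
  change _ * m.real _ / _ = _
  field_simp

/-- The expression is `l / (e^l - 1)`, which lies between `e^{-l}` and `1`. -/
theorem tendsto_mul_exp_neg_mul_inv :
    Tendsto (fun l : ℝ => l * (Real.exp (-l) * (1 - Real.exp (-l))⁻¹)) (𝓝[>] 0) (𝓝 1) := by
  have h1 : Tendsto (fun l : ℝ => Real.exp (-l)) (𝓝[>] 0) (𝓝 1) := by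
    have : Tendsto (fun l : ℝ => Real.exp (-l)) (𝓝 0) (𝓝 (Real.exp (-0))) :=
      Continuous.tendsto (by fun_prop) 0
    rw [neg_zero, Real.exp_zero] at this
    exact this.mono_left nhdsWithin_le_nhds
  refine tendsto_of_tendsto_of_tendsto_of_le_of_le' h1 tendsto_const_nhds ?_ ?_ <;>
  · filter_upwards [self_mem_nhdsWithin] with l hl
    have hl : 0 < l := hl
    have hpos : 0 < 1 - Real.exp (-l) := by simpa using hl
    have e1 := Real.add_one_le_exp (-l)
    have e2 := Real.add_one_le_exp l
    have e3 : Real.exp (-l) * Real.exp l = 1 := by rw [← Real.exp_add]; simp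
    have e4 := Real.exp_pos (-l)
    rw [← div_eq_mul_inv, ← mul_div_assoc]
    first
      | rw [le_div_iff₀ hpos]; nlinarith
      | rw [div_le_one hpos]; nlinarith

end Moments

end MomentSets

/-! ### The moment set theorem -/

theorem mainTheorem6 {X : Type*} [MeasurableSpace X] (m : Measure X) [SigmaFinite m]
    (T : X → X) (hcons : Conservative T m) (herg : Ergodic T m)
    (hwpde : MomentSets.WeaklyPointwiseDualErgodic T m)
    (A : Set X) (hA : MomentSets.IsLimitedSet T m A) :
    MomentSets.IsMomentSet T m A := by
  open MomentSets in
  have hT := herg.toMeasurePreserving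
  have hq := hT.quasiMeasurePreserving
  have hAm := hA.1
  have h0 := hA.2.1.ne'
  have htop := hA.2.2.1.ne
  refine ⟨hAm, hA.2.1, hA.2.2.1, fun p => ?_⟩
  set M := m.real A with hMdef
  have hM : 0 < M := ENNReal.toReal_pos h0 htop
  have hev := hA.eventually_dualMoment_one_le_normalization hcons hT one_lt_two
  have hrhs : ∀ l, (p.factorial : ℝ) * M ^ (p + 1) * (returnLaplace T m A l ^ p / l)
      = p.factorial * M * normalization T m A l ^ p / l := fun l => by
    rw [normalization_eq hq hAm h0 htop]
    ring
  have hg := tendsto_mul_exp_neg_mul_inv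
  simp_rw [hrhs]
  refine isEquivalent_of_tendsto_one ?_
  cases p with
  | zero =>
    -- For `p = 0` the ratio is `l / (1 - e^{-l})`; the extra summand `l` comes from the term `n =
    -- 0`, where `0^0 = 1`.
    have h1 : Tendsto (fun l : ℝ => l + l * (Real.exp (-l) * (1 - Real.exp (-l))⁻¹)) (𝓝[>] 0)
        (𝓝 (0 + 1)) := (tendsto_id.mono_left nhdsWithin_le_nhds).add hg
    rw [zero_add] at h1
    refine h1.congr' ?_
    filter_upwards [self_mem_nhdsWithin] with l hl
    have hl : 0 < l := hl
    have hpos : 0 < 1 - Real.exp (-l) := by simpa using hl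
    have hml : momentLaplace T m A 0 l = (1 - Real.exp (-l))⁻¹ * M := by
      have : ∀ n : ℕ, Real.exp (-l * n) = Real.exp (-l) ^ n := fun n => by
        rw [← Real.exp_nat_mul, mul_comm]
      simp only [momentLaplace, pow_zero, this]
      rw [tsum_mul_right, tsum_geometric_of_lt_one (Real.exp_pos _).le (by linarith)]
      simp [hMdef]
    rw [Pi.div_apply, hml]
    simp
    field_simp
    ring
  | succ r =>
    have hJ := hA.tendsto_momentIntegral hcons hT
    have hup := ((hJ (r + 1)).mul hg).div_const M
    have hinv := tendsto_inv_atTop_zero.comp (tendsto_normalization hcons hAm h0 htop)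
    -- The correction of order `r`, divided by `(r+1)! M c^(r+1) / l`, retains a factor `1 / c` and
    -- so vanishes in the limit.
    have hlow := hup.sub ((((hJ r).mul hg).mul hinv).const_mul
      (r * 2 ^ r * r.factorial / ((r + 1).factorial * M)))
    rw [mul_one, div_self hM.ne'] at hup hlow
    rw [mul_zero, mul_zero, sub_zero] at hlow
    refine tendsto_of_tendsto_of_tendsto_of_le_of_le' hlow hup ?_ ?_ <;>
    · filter_upwards [hev, self_mem_nhdsWithin] with l ⟨hc, _, hB⟩ hl
      have hl : 0 < l := hl
      obtain ⟨b1, b2⟩ := momentLaplace_bounds hq hAm htop r hl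
        (momentIntegral_ne_top hq hAm htop hB)
      simp only [Function.comp, Pi.div_apply]
      generalize (momentIntegral T m A (ENNReal.ofReal (Real.exp (-l))) (r + 1)).toReal = J₁ at *
      generalize (momentIntegral T m A (ENNReal.ofReal (Real.exp (-l))) r).toReal = J₀ at *
      generalize Real.exp (-l) * (1 - Real.exp (-l))⁻¹ = g at *
      generalize momentLaplace T m A (r + 1) l = N at *
      generalize normalization T m A l = c at *
      have hf : (0 : ℝ) < (r + 1).factorial := by positivity
      generalize ((r + 1).factorial : ℝ) = f at *
      have hd : 0 < f * M * c ^ (r + 1) / l := by positivity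
      first
        | rw [le_div_iff₀ hd]
          refine le_trans (le_of_eq ?_) (sub_le_iff_le_add.2 b2)
          field_simp
          ring
        | rw [div_le_iff₀ hd]
          refine b1.trans (le_of_eq ?_)
          field_simp
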